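/- Let $m,r\ge 2$ be integers, let $\mathbb K$ be a field, and let $S=\mathbb K[x_{ij}: i\in[m],\,j\in[n]]$. For a simple graph $H$ on $[n]$, let $\mathcal J_{K_m,H}\subseteq S$ be the ideal generated by the $2$-minors $x_{ik}x_{jl}-x_{il}x_{jk}$ with $1\le i<j\le m$, $1\le k<l\le n$ and $\{k,l\}\in E(H)$. Let $G$ be a complete $r$-partite graph on the vertex set $[n]$, that is, $[n]=V_1\sqcup\cdots\sqcup V_r$ with all $V_k$ non-empty, and two vertices are adjacent in $G$ if and only if they lie in different parts. Put $n_k=|V_k|$, and assume that $1=n_1=\cdots=n_{s-1}<n_s\le\cdots\le n_r$ for some $s\in\{1,\dots,r\}$ (so $n_r\ge 2$). Let $\widetilde G$ be the complete graph on $[n]$, and for $s\le k\le r$ let $A_k=(x_{ij}: i\in[m],\ j\in[n]\setminus V_k)$. Then $$\mathcal J_{K_m,G}=\mathcal J_{K_m,\widetilde G}\cap A_s\cap A_{s+1}\cap\cdots\cap A_r,$$ the ideals on the right-hand side are pairwise distinct, and this is the minimal primary decomposition of $\mathcal J_{K_m,G}$ (it is an irredundant primary decomposition whose components have pairwise distinct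 radicals, and it is the only one). Moreover, $$\dim(S/\mathcal J_{K_m,G})=\max\{m+n-1,\ m\,n_r\}.$$ -/

import Mathlib

/-- The binomial edge ideal `𝒥_{G₁,G₂}` of a pair of simple graphs on `[m]` and `[n]`: the ideal of
`K[x_{ij} : (i,j) ∈ [m] × [n]]` generated by the 2-minors
`[i,j | k,l] = x_{ik} x_{jl} - x_{il} x_{jk}` with `i < j`, `k < l`, `{i,j} ∈ E(G₁)` and
`{k,l} ∈ E(G₂)`. -/
noncomputable def binomialEdgeIdeal (K : Type*) [Field K] {m n : ℕ}
    (G₁ : SimpleGraph (Fin m)) (G₂ : SimpleGraph (Fin n)) :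
    Ideal (MvPolynomial (Fin m × Fin n) K) :=
  Ideal.span {p | ∃ (i j : Fin m) (k l : Fin n), i < j ∧ k < l ∧ G₁.Adj i j ∧ G₂.Adj k l ∧
    p = MvPolynomial.X (i, k) * MvPolynomial.X (j, l)
      - MvPolynomial.X (i, l) * MvPolynomial.X (j, k)}

/-- The generalized binomial edge ideal `𝒥_{K_m,G}` of a simple graph `G` on `[n]`. -/
noncomputable def genBinomialEdgeIdeal (K : Type*) [Field K] (m : ℕ) {n : ℕ} (G : SimpleGraph (Fin n)) :
    Ideal (MvPolynomial (Fin m × Fin n) K) :=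
  binomialEdgeIdeal K (SimpleGraph.completeGraph (Fin m)) G

/-- The ideal `(x_{ij} : i ∈ [m], j ∈ T)` generated by the variables in the columns in `T`. -/
noncomputable def columnIdeal (K : Type*) [Field K] (m : ℕ) {n : ℕ} (T : Finset (Fin n)) :
    Ideal (MvPolynomial (Fin m × Fin n) K) :=
  Ideal.span {p | ∃ (i : Fin m) (j : Fin n), j ∈ T ∧ p = MvPolynomial.X (i, j)}

/-- `G` is the complete `r`-partite graph with parts `V 0, …, V (r - 1)`: the parts are non-empty,
pairwise disjoint and cover the vertex set, and two vertices are adjacent exactly when they lie in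
different parts. -/
structure IsCompletePartite {n r : ℕ} (G : SimpleGraph (Fin n))
    (V : Fin r → Finset (Fin n)) : Prop where
  nonempty : ∀ k, (V k).Nonempty
  disjoint : ∀ k l, k ≠ l → Disjoint (V k) (V l)
  cover : ∀ v, ∃ k, v ∈ V k
  adj_iff : ∀ u v, G.Adj u v ↔ ∃ k l, k ≠ l ∧ u ∈ V k ∧ v ∈ V l

/-!
Write `P` for the ideal of all 2-minors and `J` for the edge ideal of the complete multipartite graph
`G`. The decomposition and the primality of `P` both follow from one statement about monomials.
Suppose that any two columns met by a monomial `x^a` are adjacent in `G` or have a common neighbour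
among the columns met by `x^a` (`IsLinked`). Then `x^a` is congruent modulo `J` to every monomial
with the same row and column sums (`mk_monomial_eq_of_margins_eq`): two such exponent matrices are
connected by transpositions of two entries, and a transposition in nonadjacent columns is a product
of three transpositions through a common neighbour. Since `x_{ij} ↦ s_i t_j` records exactly the row
and column sums, a polynomial in the kernel of this map all of whose monomials are linked lies in
`J` (`mem_genBinomialEdgeIdeal_of_isLinked`). For the complete graph every monomial is linked, so
`P` is the kernel of a map to a domain. For complete multipartite `G`, the monomials that are not
linked meet at least two columns and only columns of a single part, and membership in the
column ideals excludes these.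

All components are prime and pairwise incomparable, which makes this the unique minimal primary
decomposition (`isMinimalPrimaryDecomposition_iff_eq_of_isPrime`): in any such decomposition the
radicals of the components are these primes, and a component with radical `p` contains `p`, because
multiplication by an element of the other primes outside of `p` maps `p` into `J`.

The dimension is the maximum over the components. The quotient by a column ideal is a polynomial
ring. For `P`, two explicit chains of kernels of maps to polynomial rings suffice
(`coheight_segre`): imposing `x_{ij} = s_i t_j` entry by entry, starting from a row and a column,
gives a chain of primes of length `(m - 1) * (n - 1)` up to `P`, and setting the variables `s_i` and
`t_j` to zero one by one gives a chain of length `m + n - 1` starting at `P`. The two lengths add up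
to `m * n`, the dimension of the polynomial ring, so both chains are longest possible.
-/

/-! ### Monomials modulo the edge ideal -/

section MonomialMoves

open MvPolynomial

variable {K : Type*} [Field K] {m n : ℕ}

/-- The row and column sums of an exponent matrix, as an exponent in the variables
`s_i = X (inl i)` and `t_j = X (inr j)`. -/
noncomputable def margins (a : Fin m × Fin n →₀ ℕ) : Fin m ⊕ Fin n →₀ ℕ :=
  Finsupp.equivFunOnFinite.symm (Sum.elim (fun i => ∑ j, a (i, j)) (fun j => ∑ i, a (i, j)))

@[simp] lemma margins_inl (a : Fin m × Fin n →₀ ℕ) (i : Fin m) :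
    margins a (Sum.inl i) = ∑ j, a (i, j) := rfl

@[simp] lemma margins_inr (a : Fin m × Fin n →₀ ℕ) (j : Fin n) :
    margins a (Sum.inr j) = ∑ i, a (i, j) := rfl

lemma margins_add (a b : Fin m × Fin n →₀ ℕ) : margins (a + b) = margins a + margins b := by
  ext (i | j) <;> simp [Finset.sum_add_distrib]

lemma margins_single (i : Fin m) (j : Fin n) :
    margins (Finsupp.single (i, j) 1) =
      Finsupp.single (Sum.inl i) 1 + Finsupp.single (Sum.inr j) 1 := by
  classical
  ext (k | l)
  · simp [Finsupp.single_apply, Prod.ext_iff, ite_and]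
  · simp [Finsupp.single_apply, Prod.ext_iff, ite_and]

lemma margins_inr_ne_zero {a : Fin m × Fin n →₀ ℕ} {j : Fin n} :
    margins a (Sum.inr j) ≠ 0 ↔ ∃ i, a (i, j) ≠ 0 := by
  simp

/-- The column set `{j | e (inr j) ≠ 0}` is *linked* by `G` if any two distinct columns of it are
adjacent or have a common neighbour in it. -/
def IsLinked (G : SimpleGraph (Fin n)) (e : Fin m ⊕ Fin n →₀ ℕ) : Prop :=
  ∀ j l, j ≠ l → e (Sum.inr j) ≠ 0 → e (Sum.inr l) ≠ 0 →
    G.Adj j l ∨ ∃ q, e (Sum.inr q) ≠ 0 ∧ G.Adj q j ∧ G.Adj q l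

lemma mk_minor_eq (G : SimpleGraph (Fin n)) (i k : Fin m) {j l : Fin n} (h : G.Adj j l) :
    Ideal.Quotient.mk (genBinomialEdgeIdeal K m G) (X (i, j) * X (k, l)) =
      Ideal.Quotient.mk (genBinomialEdgeIdeal K m G) (X (i, l) * X (k, j)) := by
  -- the generators are listed with increasing rows and columns, the other orders follow by symmetry
  have key : ∀ (i k : Fin m) (j l : Fin n), i < k → j < l → G.Adj j l →
      Ideal.Quotient.mk (genBinomialEdgeIdeal K m G) (X (i, j) * X (k, l)) =
        Ideal.Quotient.mk (genBinomialEdgeIdeal K m G) (X (i, l) * X (k, j)) := by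
    intro i k j l hik hjl hadj
    rw [Ideal.Quotient.eq]
    exact Ideal.subset_span ⟨i, k, j, l, hik, hjl, by simpa using hik.ne, hadj, rfl⟩
  rcases lt_trichotomy i k with hik | rfl | hik
  · rcases h.ne.lt_or_gt with hjl | hjl
    · exact key i k j l hik hjl h
    · exact (key i k l j hik hjl h.symm).symm
  · rw [mul_comm]
  · rw [mul_comm, mul_comm (X (i, l))]
    rcases h.ne.lt_or_gt with hjl | hjl
    · exact (key k i j l hik hjl h).symm
    · exact key k i l j hik hjl h.symm

/-- Transposing two entries of a monomial in columns `j` and `l`. If `j` and `l` are not adjacent,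
the transposition `(j l)` is performed as `(j q) (l q) (j q)` through a common neighbour `q`. -/
lemma mk_monomial_move (G : SimpleGraph (Fin n)) (i k : Fin m) (j l : Fin n)
    (c : Fin m × Fin n →₀ ℕ)
    (h : G.Adj j l ∨ ∃ p q, c (p, q) ≠ 0 ∧ G.Adj q j ∧ G.Adj q l) :
    Ideal.Quotient.mk (genBinomialEdgeIdeal K m G)
        (monomial (Finsupp.single (i, l) 1 + Finsupp.single (k, j) 1 + c) 1) =
      Ideal.Quotient.mk (genBinomialEdgeIdeal K m G)
        (monomial (Finsupp.single (i, j) 1 + Finsupp.single (k, l) 1 + c) 1) := by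
  classical
  have split : ∀ (u v : Fin m × Fin n) (c : Fin m × Fin n →₀ ℕ),
      (monomial (Finsupp.single u 1 + Finsupp.single v 1 + c) 1 : MvPolynomial _ K) =
        X u * X v * monomial c 1 := by
    intro u v c
    simp [X, monomial_mul]
  rw [split, split, map_mul, map_mul _ _ (monomial c 1)]
  rcases h with h | ⟨p, q, hc, hqj, hql⟩
  · rw [mk_minor_eq G i k h]
  · obtain ⟨d, rfl⟩ : ∃ d, c = Finsupp.single (p, q) 1 + d :=
      ⟨c - Finsupp.single (p, q) 1, by
        rw [add_tsub_cancel_of_le]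
        simpa [Nat.one_le_iff_ne_zero] using hc⟩
    have hX : (monomial (Finsupp.single (p, q) 1 + d) 1 : MvPolynomial _ K) =
        X (p, q) * monomial d 1 := by
      simp [X, monomial_mul]
    have h1 := mk_minor_eq (K := K) G p k hqj
    have h2 := mk_minor_eq (K := K) G k i hql
    have h3 := mk_minor_eq (K := K) G i p hqj
    rw [hX]
    simp only [map_mul] at h1 h2 h3 ⊢
    linear_combination
      (Ideal.Quotient.mk (genBinomialEdgeIdeal K m G) (monomial d 1)) *
        (Ideal.Quotient.mk (genBinomialEdgeIdeal K m G) (X (i, l)) * h1 +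
          Ideal.Quotient.mk (genBinomialEdgeIdeal K m G) (X (p, j)) * h2 +
          Ideal.Quotient.mk (genBinomialEdgeIdeal K m G) (X (k, l)) * h3)

/-- Modulo the edge ideal, a monomial with linked columns depends only on its margins: if
`b ≠ a` have the same margins, a transposition brings `b` closer to `a`. -/
lemma mk_monomial_eq_of_margins_eq (G : SimpleGraph (Fin n)) (a b : Fin m × Fin n →₀ ℕ)
    (hab : margins b = margins a) (ha : IsLinked G (margins a)) :
    Ideal.Quotient.mk (genBinomialEdgeIdeal K m G) (monomial b 1) =
      Ideal.Quotient.mk (genBinomialEdgeIdeal K m G) (monomial a 1) := by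
  classical
  induction hN : ∑ c, (a c - b c) using Nat.strong_induction_on generalizing b with
  | _ N ih =>
  have hrow : ∀ i, ∑ j, b (i, j) = ∑ j, a (i, j) := fun i => by
    simpa using DFunLike.congr_fun hab (Sum.inl i)
  have hcol : ∀ j, ∑ i, b (i, j) = ∑ i, a (i, j) := fun j => by
    simpa using DFunLike.congr_fun hab (Sum.inr j)
  by_cases hlt : ∃ i j, b (i, j) < a (i, j)
  · obtain ⟨i, j, hij⟩ := hlt
    obtain ⟨l, hl⟩ : ∃ l, a (i, l) < b (i, l) := by
      by_contra! hcon
      exact (Finset.sum_lt_sum (fun l _ => hcon l) ⟨j, Finset.mem_univ j, hij⟩).ne (hrow i)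
    obtain ⟨k, hk⟩ : ∃ k, a (k, j) < b (k, j) := by
      by_contra! hcon
      exact (Finset.sum_lt_sum (fun l _ => hcon l) ⟨i, Finset.mem_univ i, hij⟩).ne (hcol j)
    have hjl : j ≠ l := by rintro rfl; omega
    have hik : i ≠ k := by rintro rfl; omega
    obtain ⟨c, rfl⟩ : ∃ c, b = Finsupp.single (i, l) 1 + Finsupp.single (k, j) 1 + c := by
      refine ⟨b - (Finsupp.single (i, l) 1 + Finsupp.single (k, j) 1), ?_⟩
      rw [add_tsub_cancel_of_le]
      intro x
      by_cases h1 : x = (i, l)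
      · subst h1
        have : ((k, j) : Fin m × Fin n) ≠ (i, l) := by simp [hjl]
        simp [this]
        omega
      · by_cases h2 : x = (k, j)
        · subst h2
          simp [Ne.symm h1]
          omega
        · simp [Ne.symm h1, Ne.symm h2]
    set b' := Finsupp.single (i, j) 1 + Finsupp.single (k, l) 1 + c with hb'
    have hm : margins b' = margins a := by
      rw [← hab, hb']
      simp only [margins_add, margins_single]
      abel
    rw [mk_monomial_move G i k j l c, ← hb']
    · refine ih _ ?_ b' hm rfl
      rw [← hN]
      refine Finset.sum_lt_sum (fun x _ => ?_) ⟨(i, j), Finset.mem_univ _, ?_⟩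
      · by_cases h1 : x = (i, l)
        · subst h1
          have : a (i, l) ≤ b' (i, l) := by
            simp [hb', hik.symm, hjl] at hl ⊢
            omega
          omega
        · by_cases h2 : x = (k, j)
          · subst h2
            have : a (k, j) ≤ b' (k, j) := by
              simp [hb', hik, hjl.symm] at hk ⊢
              omega
            omega
          · simp [hb', Finsupp.single_apply, Ne.symm h1, Ne.symm h2]
            omega
      · simp [hik.symm, hjl.symm, hb'] at hij ⊢
        omega
    · have hj : margins a (Sum.inr j) ≠ 0 := margins_inr_ne_zero.2 ⟨i, by omega⟩
      have hl' : margins a (Sum.inr l) ≠ 0 := by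
        rw [← hab]
        exact margins_inr_ne_zero.2 ⟨i, by omega⟩
      refine (ha j l hjl hj hl').imp_right ?_
      rintro ⟨q, hq, hqj, hql⟩
      rw [← hab] at hq
      obtain ⟨p, hp⟩ := margins_inr_ne_zero.1 hq
      refine ⟨p, q, ?_, hqj, hql⟩
      simpa [Finsupp.single_apply, hqj.ne', hql.ne'] using hp
  · push Not at hlt
    have : a = b := by
      ext ⟨i, j⟩
      exact (Finset.sum_eq_sum_iff_of_le (fun l _ => hlt i l)).1 (hrow i).symm j (Finset.mem_univ j)
    rw [this]

end MonomialMoves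

/-! ### The Segre parametrisation -/

section ToricMap

open MvPolynomial

variable {K : Type*} [Field K] {m n : ℕ}

variable (K m n) in
/-- The parametrisation `x_{ij} ↦ s_i t_j` of the matrices of rank at most one. -/
noncomputable def segreMap :
    MvPolynomial (Fin m × Fin n) K →ₐ[K] MvPolynomial (Fin m ⊕ Fin n) K :=
  aeval fun c => X (Sum.inl c.1) * X (Sum.inr c.2)

lemma segreMap_monomial (a : Fin m × Fin n →₀ ℕ) (r : K) :
    segreMap K m n (monomial a r) = monomial (margins a) r := by
  rw [segreMap, aeval_monomial, monomial_eq (s := margins a), Finsupp.prod_fintype _ _ (by simp),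
    Finsupp.prod_fintype _ _ (by simp), Fintype.prod_sum_type, Fintype.prod_prod_type]
  simp only [mul_pow, Finset.prod_mul_distrib, margins_inl, margins_inr, Finset.prod_pow_eq_pow_sum,
    algebraMap_eq]
  congr 2
  rw [Finset.prod_comm]
  simp only [Finset.prod_pow_eq_pow_sum]

lemma segreMap_eq_zero_of_mem (G : SimpleGraph (Fin n)) {f : MvPolynomial (Fin m × Fin n) K}
    (hf : f ∈ genBinomialEdgeIdeal K m G) : segreMap K m n f = 0 := by
  suffices genBinomialEdgeIdeal K m G ≤ RingHom.ker (segreMap K m n) from this hf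
  rw [genBinomialEdgeIdeal, binomialEdgeIdeal, Ideal.span_le]
  rintro _ ⟨i, j, k, l, -, -, -, -, rfl⟩
  simp only [SetLike.mem_coe, RingHom.mem_ker, segreMap, map_sub, map_mul, aeval_X]
  ring

/-- If all monomials of `f` have linked columns, then `f` lies in the edge ideal as soon as it lies
in the toric ideal. The class of such an `f` modulo the edge ideal is a linear function of
`segreMap f`: each monomial in `s` and `t` is sent to the class of a chosen monomial with these
margins. -/
lemma mem_genBinomialEdgeIdeal_of_isLinked (G : SimpleGraph (Fin n))
    {f : MvPolynomial (Fin m × Fin n) K} (hf : segreMap K m n f = 0)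
    (hlinked : ∀ a ∈ f.support, IsLinked G (margins a)) : f ∈ genBinomialEdgeIdeal K m G := by
  let ψ : MvPolynomial (Fin m ⊕ Fin n) K →ₗ[K]
      MvPolynomial (Fin m × Fin n) K ⧸ genBinomialEdgeIdeal K m G :=
    (basisMonomials _ K).constr K fun e =>
      Ideal.Quotient.mk _ (monomial (Function.invFun margins e) 1)
  have hψ : ∀ a ∈ f.support, ∀ r : K, ψ (segreMap K m n (monomial a r)) =
      Ideal.Quotient.mk (genBinomialEdgeIdeal K m G) (monomial a r) := by
    intro a ha r
    have h1 : ψ (monomial (margins a) 1) =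
        Ideal.Quotient.mk (genBinomialEdgeIdeal K m G) (monomial a 1) := by
      have := (basisMonomials (Fin m ⊕ Fin n) K).constr_basis K (fun e =>
        Ideal.Quotient.mk (genBinomialEdgeIdeal K m G)
          (monomial (Function.invFun margins e) 1)) (margins a)
      rw [coe_basisMonomials] at this
      exact this.trans (mk_monomial_eq_of_margins_eq G a _
        (Function.invFun_eq ⟨a, rfl⟩) (hlinked a ha))
    have h2 : ∀ (σ : Type) (e : σ →₀ ℕ), (monomial e r : MvPolynomial σ K) = r • monomial e 1 :=
      fun σ e => by simp [smul_monomial]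
    rw [segreMap_monomial, h2, map_smul, h1, h2]
    rfl
  rw [← Ideal.Quotient.eq_zero_iff_mem]
  have hsum : Ideal.Quotient.mk (genBinomialEdgeIdeal K m G) f = ψ (segreMap K m n f) := by
    conv_lhs => rw [← support_sum_monomial_coeff f]
    conv_rhs => rw [← support_sum_monomial_coeff f]
    simp only [map_sum]
    exact Finset.sum_congr rfl fun a ha => (hψ a ha _).symm
  rw [hsum, hf, map_zero]

/-- The ideal of all 2-minors of a generic matrix is the toric ideal of the Segre variety. -/
lemma genBinomialEdgeIdeal_completeGraph :
    genBinomialEdgeIdeal K m (SimpleGraph.completeGraph (Fin n)) = RingHom.ker (segreMap K m n) :=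
  le_antisymm (fun _ hf => segreMap_eq_zero_of_mem _ hf) fun _ hf =>
    mem_genBinomialEdgeIdeal_of_isLinked _ hf fun _ _ _ _ hjl _ _ => Or.inl hjl

lemma isPrime_genBinomialEdgeIdeal_completeGraph :
    (genBinomialEdgeIdeal K m (SimpleGraph.completeGraph (Fin n))).IsPrime := by
  rw [genBinomialEdgeIdeal_completeGraph]
  exact RingHom.ker_isPrime _

end ToricMap

/-! ### Ideals generated by columns of variables -/

section ColumnIdeal

open MvPolynomial

variable {K : Type*} [Field K] {m n : ℕ}

lemma columnIdeal_eq_span_image (T : Finset (Fin n)) :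
    columnIdeal K m T = Ideal.span (X '' {c : Fin m × Fin n | c.2 ∈ T}) := by
  rw [columnIdeal]
  congr 1
  ext p
  constructor
  · rintro ⟨i, j, hj, rfl⟩
    exact ⟨(i, j), hj, rfl⟩
  · rintro ⟨⟨i, j⟩, hj, rfl⟩
    exact ⟨i, j, hj, rfl⟩

lemma mem_columnIdeal_iff {T : Finset (Fin n)} {f : MvPolynomial (Fin m × Fin n) K} :
    f ∈ columnIdeal K m T ↔ ∀ a ∈ f.support, ∃ i, ∃ j ∈ T, a (i, j) ≠ 0 := by
  rw [columnIdeal_eq_span_image, mem_ideal_span_X_image]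
  simp

lemma X_mem_columnIdeal_iff {T : Finset (Fin n)} {i : Fin m} {j : Fin n} :
    (X (i, j) : MvPolynomial (Fin m × Fin n) K) ∈ columnIdeal K m T ↔ j ∈ T := by
  classical
  rw [mem_columnIdeal_iff]
  simp [support_X, Finsupp.single_apply]

/-- Setting the variables in the columns in `T` to zero. -/
noncomputable def killColumns (K : Type*) [Field K] (m : ℕ) {n : ℕ} (T : Finset (Fin n)) :
    MvPolynomial (Fin m × Fin n) K →ₐ[K] MvPolynomial (Fin m × {j : Fin n // j ∉ T}) K :=
  aeval fun c => if h : c.2 ∈ T then 0 else X (c.1, ⟨c.2, h⟩)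

lemma killColumns_rename (T : Finset (Fin n))
    (f : MvPolynomial (Fin m × {j : Fin n // j ∉ T}) K) :
    killColumns K m T (rename (Prod.map id Subtype.val) f) = f := by
  suffices (killColumns K m T).comp (rename (Prod.map id Subtype.val)) = AlgHom.id K _ from
    DFunLike.congr_fun this f
  ext ⟨i, j, hj⟩
  simp [killColumns, hj]

lemma ker_killColumns (T : Finset (Fin n)) :
    RingHom.ker (killColumns K m T) = columnIdeal K m T := by
  refine le_antisymm (fun f hf => ?_) ?_
  · have h : ((Ideal.Quotient.mkₐ K (columnIdeal K m T)).comp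
        (rename (Prod.map id Subtype.val))).comp (killColumns K m T) =
          Ideal.Quotient.mkₐ K (columnIdeal K m T) := by
      ext ⟨i, j⟩
      by_cases hj : j ∈ T
      · have := Ideal.Quotient.eq_zero_iff_mem.2
          ((X_mem_columnIdeal_iff (K := K) (i := i)).2 hj)
        simp [killColumns, hj, this]
      · simp [killColumns, hj]
    have hf' : killColumns K m T f = 0 := hf
    have := DFunLike.congr_fun h f
    rw [AlgHom.comp_apply, hf', map_zero] at this
    exact Ideal.Quotient.eq_zero_iff_mem.1 this.symm
  · rw [columnIdeal, Ideal.span_le]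
    rintro _ ⟨i, j, hj, rfl⟩
    simp [killColumns, RingHom.mem_ker, hj]

lemma isPrime_columnIdeal (T : Finset (Fin n)) : (columnIdeal K m T).IsPrime := by
  rw [← ker_killColumns]
  exact RingHom.ker_isPrime _

lemma ringKrullDim_quotient_columnIdeal_compl (T : Finset (Fin n)) :
    ringKrullDim (MvPolynomial (Fin m × Fin n) K ⧸ columnIdeal K m Tᶜ) =
      ((m * T.card : ℕ) : WithBot ℕ∞) := by
  have hs : Function.Surjective (killColumns K m Tᶜ).toRingHom :=
    fun f => ⟨_, killColumns_rename _ f⟩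
  rw [← ker_killColumns]
  refine (ringKrullDim_eq_of_ringEquiv (RingHom.quotientKerEquivOfSurjective hs)).trans ?_
  rw [MvPolynomial.ringKrullDim_of_isNoetherianRing, ringKrullDim_eq_zero_of_field, zero_add]
  simp

end ColumnIdeal

/-! ### Finite intersections of prime ideals -/

section PrimeIntersections

/-- A finite irredundant intersection of primes has a unique minimal primary decomposition. -/
lemma isMinimalPrimaryDecomposition_iff_eq_of_isPrime {R : Type*} [CommRing R] {J : Ideal R}
    {t : Finset (Ideal R)} (hinf : t.inf id = J) (hprime : ∀ p ∈ t, p.IsPrime)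
    (hanti : ∀ p ∈ t, ∀ q ∈ t, p ≤ q → p = q) (u : Finset (Ideal R)) :
    Submodule.IsMinimalPrimaryDecomposition J u ↔ u = t := by
  classical
  have ht : Submodule.IsMinimalPrimaryDecomposition J t := by
    refine ⟨hinf, fun p hp => (hprime p hp).isPrimary, fun p hp q hq hpq => ?_, fun p hp hle => ?_⟩
    · simpa [Function.onFun, (hprime p hp).radical, (hprime q hq).radical] using hpq
    · obtain ⟨q, hq, hqp⟩ := ((hprime p hp).inf_le').1 hle
      exact (Finset.mem_erase.1 hq).1 (hanti q (Finset.mem_of_mem_erase hq) p hp hqp)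
  refine ⟨fun hu => ?_, fun h => h ▸ ht⟩
  have himage := hu.image_radical_eq_associated_primes.trans
    ht.image_radical_eq_associated_primes.symm
  simp only [Submodule.colon_univ] at himage
  -- a component equals its radical `p`: it contains `p * s` for some `s ∉ p` in all other primes
  have hrad : ∀ q ∈ u, q.radical ∈ t ∧ q = q.radical := by
    intro q hq
    obtain ⟨p, hp, hpq⟩ : q.radical ∈ Ideal.radical '' (t : Set (Ideal R)) := by
      rw [← himage]
      exact ⟨q, hq, rfl⟩
    rw [(hprime p hp).radical] at hpq
    refine ⟨hpq ▸ hp, le_antisymm Ideal.le_radical ?_⟩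
    rw [← hpq]
    obtain ⟨s, hs, hsp⟩ := SetLike.not_le_iff_exists.1 (ht.minimal hp)
    intro x hx
    have hxs : x * s ∈ q := by
      have : J ≤ q := hu.inf_eq ▸ Finset.inf_le (f := id) hq
      refine this (hinf ▸ ?_)
      rw [← Finset.insert_erase hp, Finset.inf_insert]
      exact ⟨Ideal.mul_mem_right s p hx, Ideal.mul_mem_left _ x hs⟩
    refine ((Ideal.isPrimary_iff.1 (hu.primary hq)).2 hxs).resolve_right ?_
    rwa [← hpq]
  ext p
  refine ⟨fun hp => (hrad p hp).2 ▸ (hrad p hp).1, fun hp => ?_⟩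
  obtain ⟨q, hq, hqp⟩ : p ∈ Ideal.radical '' (u : Set (Ideal R)) := by
    rw [himage]
    exact ⟨p, hp, (hprime p hp).radical⟩
  rw [← hqp, ← (hrad q hq).2]
  exact hq

lemma ringKrullDim_quotient_le_of_inf_le {R : Type*} [CommRing R] {J : Ideal R}
    {t : Finset (Ideal R)} (hinf : t.inf id ≤ J) {d : WithBot ℕ∞}
    (hd : ∀ I ∈ t, ringKrullDim (R ⧸ I) ≤ d) : ringKrullDim (R ⧸ J) ≤ d := by
  rw [ringKrullDim_quotient, Order.krullDim]
  refine iSup_le fun l => ?_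
  -- the smallest prime of a chain contains one of the ideals of `t`
  obtain ⟨I, hI, hle⟩ := (l.head.1.2.inf_le').1 (hinf.trans l.head.2)
  refine le_trans ?_ (hd I hI)
  rw [ringKrullDim_quotient]
  have hmem : ∀ i, (l i).1 ∈ PrimeSpectrum.zeroLocus (I : Set R) := fun i =>
    hle.trans (LTSeries.head_le l i)
  exact Order.LTSeries.length_le_krullDim
    (⟨l.length, fun i => ⟨(l i).1, hmem i⟩, fun i => l.step i⟩ :
      LTSeries (PrimeSpectrum.zeroLocus (I : Set R)))

end PrimeIntersections

/-! ### The dimension of the ring of generic rank-one matrices -/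

section SegreDimension

open MvPolynomial

/-- The kernel of the `K`-algebra map sending each variable `X c` to `v c`, as a point of the prime
spectrum. -/
noncomputable def kerAeval {K σ A : Type*} [Field K] [CommRing A] [IsDomain A] [Algebra K A]
    (v : σ → A) : PrimeSpectrum (MvPolynomial σ K) :=
  ⟨RingHom.ker (aeval v : MvPolynomial σ K →ₐ[K] A), RingHom.ker_isPrime _⟩

lemma kerAeval_lt {K σ A : Type*} [Field K] [CommRing A] [IsDomain A] [Algebra K A]
    (v w : σ → A) (g : A →ₐ[K] A) (hg : ∀ c, g (v c) = w c) (f : MvPolynomial σ K)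
    (hw : aeval w f = 0) (hv : aeval v f ≠ 0) : kerAeval (K := K) v < kerAeval w := by
  refine lt_of_le_not_ge (fun x hx => ?_) fun h => hv (h hw)
  have : (aeval w : MvPolynomial σ K →ₐ[K] A) = g.comp (aeval v) := by
    ext c
    simp [hg]
  have hx' : aeval v x = 0 := hx
  change aeval w x = 0
  rw [this, AlgHom.comp_apply, hx', map_zero]

lemma coheight_eq_ringKrullDim_quotient {R : Type*} [CommRing R] (p : PrimeSpectrum R) :
    (Order.coheight p : WithBot ℕ∞) = ringKrullDim (R ⧸ p.asIdeal) := by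
  rw [ringKrullDim_quotient, Order.coheight_eq_krullDim_Ici]
  rfl

variable {K : Type*} [Field K] {m n : ℕ}

/-- Sending `x_{ij}` to `s_i t_j` for `(i, j)` in `T` and to a new variable otherwise. -/
noncomputable def partialSegre (K : Type*) [Field K] {m n : ℕ} (T : Finset (Fin m × Fin n))
    (c : Fin m × Fin n) : MvPolynomial ((Fin m ⊕ Fin n) ⊕ (Fin m × Fin n)) K :=
  if c ∈ T then X (Sum.inl (Sum.inl c.1)) * X (Sum.inl (Sum.inr c.2)) else X (Sum.inr c)

/-- The matrix `s_i t_j` with the variables in `U` set to zero. -/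
noncomputable def truncatedSegre (K : Type*) [Field K] {m n : ℕ} (U : Finset (Fin m ⊕ Fin n))
    (c : Fin m × Fin n) : MvPolynomial (Fin m ⊕ Fin n) K :=
  (if Sum.inl c.1 ∈ U then 0 else X (Sum.inl c.1)) *
    (if Sum.inr c.2 ∈ U then 0 else X (Sum.inr c.2))

/-- Enlarging `T` by one entry outside the cross through `(i₀, j₀)` adds the minor of that entry
with the cross to the kernel. -/
lemma card_le_height_partialSegre (i₀ : Fin m) (j₀ : Fin n) (T : Finset (Fin m × Fin n))
    (hT : ∀ c ∈ T, c.1 ≠ i₀ ∧ c.2 ≠ j₀) :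
    (T.card : ℕ∞) ≤ Order.height (kerAeval (K := K)
      (partialSegre K (T ∪ Finset.univ.filter fun c => c.1 = i₀ ∨ c.2 = j₀))) := by
  classical
  induction T using Finset.induction_on with
  | empty => simp
  | insert c T hc ih =>
    rw [Finset.card_insert_of_notMem hc, Nat.cast_add, Nat.cast_one]
    refine (add_le_add_left (ih fun d hd => hT d (Finset.mem_insert_of_mem hd)) 1).trans
      (Order.height_add_one_le ?_)
    obtain ⟨h1, h2⟩ := hT c (Finset.mem_insert_self c T)
    refine kerAeval_lt _ _ (aeval (Sum.elim (fun x => X (Sum.inl x)) fun d =>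
        if d = c then X (Sum.inl (Sum.inl c.1)) * X (Sum.inl (Sum.inr c.2)) else X (Sum.inr d)))
      (fun d => ?_) (X c * X (i₀, j₀) - X (i₀, c.2) * X (c.1, j₀)) ?_ ?_
    · by_cases hd : d = c
      · subst hd
        simp [partialSegre, hc, h1, h2]
      · simp only [partialSegre, Finset.mem_union, Finset.mem_insert, hd, false_or]
        split_ifs <;> simp [hd]
    · simp [partialSegre]
      ring
    · have h3 : c ∉ T ∪ Finset.univ.filter fun c => c.1 = i₀ ∨ c.2 = j₀ := by simp [hc, h1, h2]
      simp only [map_sub, map_mul, aeval_X, partialSegre, if_neg h3]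
      simp only [Finset.mem_union, Finset.mem_filter, Finset.mem_univ, true_and, true_or, or_true,
        if_true]
      intro h
      -- setting the new variable to zero and all others to one gives `-1`
      have := congrArg (aeval (R := K) (Sum.elim (fun _ => (1 : K)) fun _ => 0)) h
      simp at this

lemma kerAeval_truncatedSegre_lt {U U' : Finset (Fin m ⊕ Fin n)} (h : U ⊆ U') (i : Fin m)
    (j : Fin n) (hi : Sum.inl i ∉ U) (hj : Sum.inr j ∉ U)
    (hij : Sum.inl i ∈ U' ∨ Sum.inr j ∈ U') :
    kerAeval (K := K) (truncatedSegre K U) < kerAeval (truncatedSegre K U') := by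
  refine kerAeval_lt _ _ (aeval fun x => if x ∈ U' then 0 else X x) (fun c => ?_) (X (i, j)) ?_ ?_
  · have key : ∀ x, aeval (fun x => if x ∈ U' then 0 else X x)
        (if x ∈ U then 0 else X x : MvPolynomial (Fin m ⊕ Fin n) K) =
          (if x ∈ U' then 0 else X x : MvPolynomial (Fin m ⊕ Fin n) K) := by
      intro x
      by_cases hx : x ∈ U
      · simp [hx, h hx]
      · simp [hx]
    rw [truncatedSegre, map_mul, key, key, truncatedSegre]
  · rcases hij with hij | hij <;> simp [truncatedSegre, hij]
  · simp [truncatedSegre, hi, hj]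

lemma coheight_truncatedSegre_add_card_le (i₀ : Fin m) (j₀ : Fin n) (U : Finset (Fin m ⊕ Fin n))
    (hi : Sum.inl i₀ ∉ U) (hj : Sum.inr j₀ ∉ U) :
    Order.coheight (kerAeval (K := K) (truncatedSegre K U)) + U.card ≤
      Order.coheight (kerAeval (K := K) (truncatedSegre K (∅ : Finset (Fin m ⊕ Fin n)))) := by
  classical
  induction U using Finset.induction_on with
  | empty => simp
  | insert x U hx ih =>
    simp only [Finset.mem_insert, not_or] at hi hj
    refine le_trans ?_ (ih hi.2 hj.2)
    rw [Finset.card_insert_of_notMem hx, Nat.cast_add, Nat.cast_one, add_comm (U.card : ℕ∞),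
      ← add_assoc]
    gcongr
    apply Order.coheight_add_one_le
    rcases x with i | j
    · exact kerAeval_truncatedSegre_lt (Finset.subset_insert _ _) i j₀ hx hj.2 (by simp)
    · exact kerAeval_truncatedSegre_lt (Finset.subset_insert _ _) i₀ j hi.2 hx (by simp)

lemma le_coheight_segre (i₀ : Fin m) (j₀ : Fin n) : ((m + n - 1 : ℕ) : ℕ∞) ≤
    Order.coheight (kerAeval (K := K) (truncatedSegre K (∅ : Finset (Fin m ⊕ Fin n)))) := by
  classical
  set U : Finset (Fin m ⊕ Fin n) := (Finset.univ.erase (Sum.inl i₀)).erase (Sum.inr j₀) with hU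
  have hcard : U.card = m + n - 2 := by
    rw [hU, Finset.card_erase_of_mem (by simp), Finset.card_erase_of_mem (by simp)]
    simp
    omega
  refine le_trans ?_ (coheight_truncatedSegre_add_card_le i₀ j₀ U (by simp [U]) (by simp [U]))
  have h1 : (1 : ℕ∞) ≤ Order.coheight (kerAeval (K := K) (truncatedSegre K U)) :=
    le_trans (by simp) (Order.coheight_add_one_le (kerAeval_truncatedSegre_lt
      (Finset.subset_univ U) i₀ j₀ (by simp [U]) (by simp [U]) (by simp)))
  have h2 : m + n - 1 = 1 + (m + n - 2) := by
    have := i₀.pos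
    have := j₀.pos
    omega
  rw [hcard, h2, Nat.cast_add, Nat.cast_one]
  gcongr

lemma kerAeval_partialSegre_univ :
    kerAeval (K := K) (partialSegre K (Finset.univ : Finset (Fin m × Fin n))) =
      kerAeval (truncatedSegre K ∅) := by
  ext f
  have h : (aeval (partialSegre K Finset.univ) : MvPolynomial (Fin m × Fin n) K →ₐ[K] _) =
      (rename Sum.inl).comp (aeval (truncatedSegre K ∅)) := by
    ext c
    simp [partialSegre, truncatedSegre]
  change aeval (partialSegre K Finset.univ) f = 0 ↔ aeval (truncatedSegre K ∅) f = 0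
  rw [h, AlgHom.comp_apply, map_eq_zero_iff _ (rename_injective _ Sum.inl_injective)]

lemma le_height_segre (i₀ : Fin m) (j₀ : Fin n) : (((m - 1) * (n - 1) : ℕ) : ℕ∞) ≤
    Order.height (kerAeval (K := K) (truncatedSegre K (∅ : Finset (Fin m ⊕ Fin n)))) := by
  classical
  have h := card_le_height_partialSegre (K := K) i₀ j₀
    (Finset.univ.erase i₀ ×ˢ Finset.univ.erase j₀) (by simp)
  rw [Finset.card_product, Finset.card_erase_of_mem (by simp), Finset.card_erase_of_mem (by simp),
    Finset.card_univ, Finset.card_univ, Fintype.card_fin, Fintype.card_fin] at h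
  convert h using 2
  rw [← kerAeval_partialSegre_univ]
  congr 2
  ext c
  simp
  tauto

/-- The dimension of the affine cone over the Segre variety. The chain of partial toric ideals below
the toric ideal bounds it from above, the chain of truncations above it from below. -/
lemma coheight_segre (hm : 0 < m) (hn : 0 < n) :
    Order.coheight (kerAeval (K := K) (truncatedSegre K (∅ : Finset (Fin m ⊕ Fin n)))) =
      (m + n - 1 : ℕ) := by
  refine le_antisymm ?_ (le_coheight_segre ⟨0, hm⟩ ⟨0, hn⟩)
  have h1 : Order.height (kerAeval (K := K) (truncatedSegre K (∅ : Finset (Fin m ⊕ Fin n)))) +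
      Order.coheight (kerAeval (K := K) (truncatedSegre K (∅ : Finset (Fin m ⊕ Fin n)))) ≤
        (m * n : ℕ) := by
    have hd : ringKrullDim (MvPolynomial (Fin m × Fin n) K) = ((m * n : ℕ) : ℕ∞) := by
      rw [MvPolynomial.ringKrullDim_of_isNoetherianRing, ringKrullDim_eq_zero_of_field, zero_add]
      simp
    rw [ringKrullDim, Order.krullDim_eq_iSup_height_add_coheight_of_nonempty,
      WithBot.coe_inj] at hd
    rw [← hd]
    exact le_iSup (fun p : PrimeSpectrum (MvPolynomial (Fin m × Fin n) K) =>
      Order.height p + Order.coheight p) _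
  have h2 := (add_le_add_left (le_height_segre (K := K) ⟨0, hm⟩ ⟨0, hn⟩) _).trans h1
  have h3 : m * n = (m - 1) * (n - 1) + (m + n - 1) := by
    obtain ⟨m, rfl⟩ := Nat.exists_eq_succ_of_ne_zero hm.ne'
    obtain ⟨n, rfl⟩ := Nat.exists_eq_succ_of_ne_zero hn.ne'
    simp only [Nat.succ_eq_add_one, Nat.add_sub_cancel]
    have : m + 1 + (n + 1) - 1 = m + n + 1 := by omega
    rw [this]
    ring
  rw [h3, Nat.cast_add] at h2
  exact (ENat.add_le_add_iff_left (ENat.natCast_ne_top _)).1 h2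

end SegreDimension

/-! ### Complete multipartite graphs -/

section CompleteMultipartite

open MvPolynomial

variable {K : Type*} [Field K] {m n r : ℕ}

lemma ringKrullDim_quotient_completeGraph (hm : 0 < m) (hn : 0 < n) :
    ringKrullDim (MvPolynomial (Fin m × Fin n) K ⧸
      genBinomialEdgeIdeal K m (SimpleGraph.completeGraph (Fin n))) =
        ((m + n - 1 : ℕ) : WithBot ℕ∞) := by
  have h : genBinomialEdgeIdeal K m (SimpleGraph.completeGraph (Fin n)) =
      (kerAeval (K := K) (truncatedSegre K (∅ : Finset (Fin m ⊕ Fin n)))).asIdeal := by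
    rw [genBinomialEdgeIdeal_completeGraph]
    have hv : (truncatedSegre K (∅ : Finset (Fin m ⊕ Fin n))) =
        fun c => X (Sum.inl c.1) * X (Sum.inr c.2) := by
      funext c
      simp [truncatedSegre]
    rw [kerAeval, hv]
    rfl
  rw [h, ← coheight_eq_ringKrullDim_quotient, coheight_segre hm hn]
  rfl

lemma genBinomialEdgeIdeal_mono {G H : SimpleGraph (Fin n)} (h : G ≤ H) :
    genBinomialEdgeIdeal K m G ≤ genBinomialEdgeIdeal K m H := by
  refine Ideal.span_mono ?_
  rintro _ ⟨i, j, k, l, hij, hkl, hij', hkl', rfl⟩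
  exact ⟨i, j, k, l, hij, hkl, hij', h hkl', rfl⟩

variable {G : SimpleGraph (Fin n)} {V : Fin r → Finset (Fin n)}

namespace IsCompletePartite

lemma eq_of_mem (hG : IsCompletePartite G V) {v : Fin n} {k l : Fin r} (hk : v ∈ V k)
    (hl : v ∈ V l) : k = l := by
  by_contra h
  exact Finset.disjoint_left.1 (hG.disjoint k l h) hk hl

lemma adj_of_mem_of_notMem (hG : IsCompletePartite G V) {u v : Fin n} {k : Fin r} (hu : u ∈ V k)
    (hv : v ∉ V k) : G.Adj u v := by
  obtain ⟨l, hl⟩ := hG.cover v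
  exact (hG.adj_iff u v).2 ⟨k, l, fun h => hv (h ▸ hl), hu, hl⟩

lemma not_adj (hG : IsCompletePartite G V) {u v : Fin n} {k : Fin r} (hu : u ∈ V k)
    (hv : v ∈ V k) : ¬ G.Adj u v := by
  intro h
  obtain ⟨k', l', hne, hk, hl⟩ := (hG.adj_iff u v).1 h
  exact hne ((hG.eq_of_mem hk hu).trans (hG.eq_of_mem hv hl))

lemma genBinomialEdgeIdeal_le_columnIdeal (hG : IsCompletePartite G V) (k : Fin r) :
    genBinomialEdgeIdeal K m G ≤ columnIdeal K m (V k)ᶜ := by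
  rw [genBinomialEdgeIdeal, binomialEdgeIdeal, Ideal.span_le]
  rintro _ ⟨i, j, u, v, -, -, -, huv, rfl⟩
  have hX : ∀ {w : Fin n}, w ∉ V k → ∀ i : Fin m,
      (X (i, w) : MvPolynomial (Fin m × Fin n) K) ∈ columnIdeal K m (V k)ᶜ :=
    fun hw i => X_mem_columnIdeal_iff.2 (by simpa using hw)
  by_cases hu : u ∈ V k
  · have hv : v ∉ V k := fun hv => hG.not_adj hu hv huv
    exact sub_mem (Ideal.mul_mem_left _ _ (hX hv j)) (Ideal.mul_mem_right _ _ (hX hv i))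
  · exact sub_mem (Ideal.mul_mem_right _ _ (hX hu i)) (Ideal.mul_mem_left _ _ (hX hu j))

/-- The column set of a monomial is linked by `G` unless it has at least two elements and is
contained in a part. In the latter case the monomial is outside one of the column ideals. -/
lemma genBinomialEdgeIdeal_eq (hG : IsCompletePartite G V) {I : Finset (Fin r)}
    (hI : ∀ k ∉ I, (V k).card ≤ 1) :
    genBinomialEdgeIdeal K m G = genBinomialEdgeIdeal K m (SimpleGraph.completeGraph (Fin n)) ⊓
      ⨅ i ∈ I, columnIdeal K m (V i)ᶜ := by
  refine le_antisymm (le_inf (genBinomialEdgeIdeal_mono fun _ _ h => h.ne)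
    (le_iInf₂ fun i _ => hG.genBinomialEdgeIdeal_le_columnIdeal i)) ?_
  rintro f ⟨hf, hfI⟩
  simp only [SetLike.mem_coe, Submodule.mem_iInf] at hfI
  refine mem_genBinomialEdgeIdeal_of_isLinked G (segreMap_eq_zero_of_mem _ hf)
    fun a ha j l hjl hj hl => or_iff_not_imp_left.2 fun hadj => ?_
  obtain ⟨k, hk⟩ := hG.cover j
  have hlk : l ∈ V k := by
    by_contra hlk
    exact hadj (hG.adj_of_mem_of_notMem hk hlk)
  have hkI : k ∈ I := by
    by_contra hkI
    exact hjl (Finset.card_le_one.1 (hI k hkI) j hk l hlk)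
  obtain ⟨p, q, hq, hpq⟩ := mem_columnIdeal_iff.1 (hfI k hkI) a ha
  have hq' : q ∉ V k := by simpa using hq
  exact ⟨q, margins_inr_ne_zero.2 ⟨p, hpq⟩, (hG.adj_of_mem_of_notMem hk hq').symm,
    (hG.adj_of_mem_of_notMem hlk hq').symm⟩

end IsCompletePartite

lemma columnIdeal_le_columnIdeal_iff (hm : 0 < m) {T U : Finset (Fin n)} :
    columnIdeal K m T ≤ columnIdeal K m U ↔ T ⊆ U := by
  constructor
  · intro h j hj
    exact (X_mem_columnIdeal_iff (K := K) (i := ⟨0, hm⟩)).1 (h (X_mem_columnIdeal_iff.2 hj))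
  · intro h
    rw [columnIdeal, Ideal.span_le]
    rintro _ ⟨i, j, hj, rfl⟩
    exact X_mem_columnIdeal_iff.2 (h hj)

lemma not_columnIdeal_le_completeGraph (hm : 0 < m) {T : Finset (Fin n)} (hT : T.Nonempty) :
    ¬ columnIdeal K m T ≤ genBinomialEdgeIdeal K m (SimpleGraph.completeGraph (Fin n)) := by
  obtain ⟨j, hj⟩ := hT
  intro h
  have := segreMap_eq_zero_of_mem _
    (h (X_mem_columnIdeal_iff (K := K) (i := (⟨0, hm⟩ : Fin m)) |>.2 hj))
  simp [segreMap] at this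

/-- A minor in two columns outside `T` is not in the ideal of the columns in `T`, as it does not
vanish at a suitable matrix with zero columns in `T`. -/
lemma not_completeGraph_le_columnIdeal (hm : 2 ≤ m) {T : Finset (Fin n)} (hT : 1 < Tᶜ.card) :
    ¬ genBinomialEdgeIdeal K m (SimpleGraph.completeGraph (Fin n)) ≤ columnIdeal K m T := by
  obtain ⟨u, hu, v, hv, huv⟩ := Finset.one_lt_card.1 hT
  intro h
  have hmem := h (Ideal.Quotient.eq.1 (mk_minor_eq (K := K) (SimpleGraph.completeGraph (Fin n))
    (⟨0, by omega⟩ : Fin m) ⟨1, by omega⟩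
    (show (SimpleGraph.completeGraph (Fin n)).Adj u v from huv)))
  rw [← ker_killColumns, RingHom.mem_ker] at hmem
  rw [Finset.mem_compl] at hu hv
  have := congrArg (aeval (R := K) fun c : Fin m × {j : Fin n // j ∉ T} =>
    if (c.1.1 = 0 ∧ c.2.1 = u) ∨ (c.1.1 = 1 ∧ c.2.1 = v) then (1 : K) else 0) hmem
  simp [killColumns, hu, hv, huv] at this

end CompleteMultipartite

theorem mainTheorem3 {K : Type*} [Field K] (m n r : ℕ) (hm : 2 ≤ m) (hr : 2 ≤ r)
    (G : SimpleGraph (Fin n)) (V : Fin r → Finset (Fin n)) (hG : IsCompletePartite G V)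
    (hmono : ∀ i j : Fin r, i ≤ j → (V i).card ≤ (V j).card)
    (s : Fin r) (hs_lt : ∀ i : Fin r, i < s → (V i).card = 1) (hs : 1 < (V s).card) :
    -- the decomposition
    genBinomialEdgeIdeal K m G =
      genBinomialEdgeIdeal K m (SimpleGraph.completeGraph (Fin n)) ⊓
        ⨅ i ∈ Finset.Ici s, columnIdeal K m (V i)ᶜ ∧
    -- the listed components are pairwise distinct
    Set.InjOn (fun i : Fin r => columnIdeal K m (V i)ᶜ) (Set.Ici s) ∧
    (∀ i : Fin r, s ≤ i →
      genBinomialEdgeIdeal K m (SimpleGraph.completeGraph (Fin n)) ≠ columnIdeal K m (V i)ᶜ) ∧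
    -- they form a minimal primary decomposition, and it is the only one
    (∀ t : Finset (Ideal (MvPolynomial (Fin m × Fin n) K)),
      Submodule.IsMinimalPrimaryDecomposition (genBinomialEdgeIdeal K m G) t ↔
        t = insert (genBinomialEdgeIdeal K m (SimpleGraph.completeGraph (Fin n)))
          ((Finset.Ici s).image fun i => columnIdeal K m (V i)ᶜ)) ∧
    -- the Krull dimension
    ringKrullDim (MvPolynomial (Fin m × Fin n) K ⧸ genBinomialEdgeIdeal K m G) =
      ((max (m + n - 1) (m * (V ⟨r - 1, by omega⟩).card) : ℕ) : WithBot ℕ∞) := by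
  have hm0 : 0 < m := by omega
  have hn0 : 0 < n := by
    obtain ⟨v, -⟩ := hG.nonempty s
    exact v.pos
  have hcard : ∀ i, s ≤ i → 1 < (V i).card := fun i hi => hs.trans_le (hmono s i hi)
  have hdec := hG.genBinomialEdgeIdeal_eq (K := K) (m := m) (I := Finset.Ici s)
    (fun k hk => (hs_lt k (by simpa using hk)).le)
  have hle : ∀ i j, columnIdeal K m (V i)ᶜ ≤ columnIdeal K m (V j)ᶜ → i = j := by
    intro i j h
    rw [columnIdeal_le_columnIdeal_iff hm0, Finset.compl_subset_compl] at h
    obtain ⟨v, hv⟩ := hG.nonempty j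
    exact hG.eq_of_mem (h hv) hv
  have hP : ∀ i, s ≤ i → ¬ genBinomialEdgeIdeal K m (SimpleGraph.completeGraph (Fin n)) ≤
      columnIdeal K m (V i)ᶜ := fun i hi =>
    not_completeGraph_le_columnIdeal hm (by rw [compl_compl]; exact hcard i hi)
  have hP' : ∀ i, ¬ columnIdeal K m (V i)ᶜ ≤
      genBinomialEdgeIdeal K m (SimpleGraph.completeGraph (Fin n)) := by
    intro i
    apply not_columnIdeal_le_completeGraph hm0
    -- since `r ≥ 2`, there is a part other than `V i`
    have : Nontrivial (Fin r) := Fin.nontrivial_iff_two_le.2 hr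
    obtain ⟨j, hj⟩ := exists_ne i
    obtain ⟨v, hv⟩ := hG.nonempty j
    exact ⟨v, Finset.mem_compl.2 fun h => hj (hG.eq_of_mem hv h)⟩
  have hinf : (insert (genBinomialEdgeIdeal K m (SimpleGraph.completeGraph (Fin n)))
      ((Finset.Ici s).image fun i => columnIdeal K m (V i)ᶜ)).inf id =
        genBinomialEdgeIdeal K m G := by
    rw [hdec, Finset.inf_insert, Finset.inf_image, Finset.inf_eq_iInf]
    rfl
  refine ⟨hdec, fun i _ j _ h => hle i j h.le, fun i hi h => hP i hi h.le, fun t => ?_, ?_⟩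
  · refine isMinimalPrimaryDecomposition_iff_eq_of_isPrime hinf ?_ ?_ t
    · simp only [Finset.mem_insert, Finset.mem_image]
      rintro _ (rfl | ⟨i, -, rfl⟩)
      · exact isPrime_genBinomialEdgeIdeal_completeGraph
      · exact isPrime_columnIdeal _
    · simp only [Finset.mem_insert, Finset.mem_image, Finset.mem_Ici]
      rintro _ (rfl | ⟨i, hi, rfl⟩) _ (rfl | ⟨j, hj, rfl⟩) h
      · rfl
      · exact (hP j hj h).elim
      · exact (hP' i h).elim
      · rw [hle i j h]
  · refine le_antisymm (ringKrullDim_quotient_le_of_inf_le hinf.le ?_) ?_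
    · simp only [Finset.mem_insert, Finset.mem_image, Finset.mem_Ici]
      rintro _ (rfl | ⟨i, -, rfl⟩)
      · rw [ringKrullDim_quotient_completeGraph hm0 hn0]
        exact_mod_cast le_max_left _ _
      · rw [ringKrullDim_quotient_columnIdeal_compl]
        have : m * (V i).card ≤ m * (V ⟨r - 1, by omega⟩).card :=
          Nat.mul_le_mul_left m (hmono _ _ (Fin.le_def.2 (by have := i.2; simp; omega)))
        exact_mod_cast this.trans (le_max_right _ _)
    · rcases max_choice (m + n - 1) (m * (V ⟨r - 1, by omega⟩).card) with h | h <;> rw [h]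
      · rw [← ringKrullDim_quotient_completeGraph (K := K) hm0 hn0]
        exact ringKrullDim_le_of_surjective _ (Ideal.Quotient.factor_surjective
          (genBinomialEdgeIdeal_mono fun _ _ h => h.ne))
      · rw [← ringKrullDim_quotient_columnIdeal_compl (K := K)]
        exact ringKrullDim_le_of_surjective _ (Ideal.Quotient.factor_surjective
          (hG.genBinomialEdgeIdeal_le_columnIdeal _))
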